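/- Let $\mathcal H$ be a complex Hilbert space (of arbitrary dimension), $|\psi\rangle\in\mathcal H$ a unit vector, and $A_1,\dots,A_6$ $\pm1$-valued projective observables on $\mathcal H$, i.e. self-adjoint operators with $A_i^2=\mathbb 1$; no commutation relations are assumed. For sequential measurements, let $\langle A_iA_j\rangle_\pi=\sum_{a,b=\pm1}ab\,P(a,b|A_i,A_j)$ and $\langle A_iA_jA_k\rangle_\pi=\sum_{a,b,c=\pm1}abc\,P(a,b,c|A_i,A_j,A_k)$, where $P(a,b|A_i,A_j)=\|\Pi_j^{b}\Pi_i^{a}\psi\|^2$ and $P(a,b,c|A_i,A_j,A_k)=\|\Pi_k^{c}\Pi_j^{b}\Pi_i^{a}\psi\|^2$ are the joint outcome probabilities when the observables are measured in the order written, with $\Pi_i^{a}=\frac12(\mathbb 1+aA_i)$. Put $$\mathcal I_T=\tfrac12\big(\langle A_1A_2A_3\rangle_\pi+\langle A_2A_1A_3\rangle_\pi+\langle A_4A_5A_6\rangle_\pi+\langle A_5A_4A_6\rangle_\pi\big)+\langle A_1A_4\rangle_\pi+\langle A_2A_5\rangle_\pi-\langle A_3A_6\rangle_\pi ,$$ whose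 maximal quantum value is $5$. There are positive constants $\epsilon_0,m_1,m_2,s_1,s_2,s_3$, independent of $\mathcal H$, $|\psi\rangle$, the $A_i$ and $\epsilon$, such that the following holds. If $\mathcal I_T=5-\epsilon$, and if $\epsilon\le\epsilon_0$ or $\dim\mathcal H\ge 4$, then there exist a projection $P:\mathcal H\to V=\mathbb C^2\otimes\mathbb C^2$ (an operator with $PP^\dagger=\mathbb 1_V$, so that $P^\dagger$ identifies $V$ with a four-dimensional subspace of $\mathcal H$) and a unitary $U$ on $V$ such that $\|P|\psi\rangle\|=1$ and, with $\hat A_i^{noisy}=PA_iP^\dagger$ and $|\hat\psi\rangle=U^\dagger P|\psi\rangle$, $$\big\|U^\dagger \hat A_i^{noisy}U-\hat A_i^{opt}\big\|\le m_1\sqrt\epsilon+m_2\,\epsilon^{1/4}\quad(i=1,\dots,6),$$ $$|\langle\hat\psi|\phi^+\rangle|^2\ge 1-\big(s_1\epsilon+s_2\epsilon^{3/4}+s_3\sqrt\epsilon\big).$$ Here $\|\cdot\|$ is the operator norm, $|\phi^+\rangle=(|00\rangle+|11\rangle)/\sqrt2$, and, with the Pauli matrices $X,Z$, $$\hat A_1^{opt}=X\otimes\mathbb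 1,\ \hat A_2^{opt}=\mathbb 1\otimes Z,\ \hat A_3^{opt}=X\otimes Z,\ \hat A_4^{opt}=\mathbb 1\otimes X,\ \hat A_5^{opt}=Z\otimes\mathbb 1,\ \hat A_6^{opt}=Z\otimes X.$$ -/

import Mathlib

open scoped Kronecker

noncomputable section

/-! ### Sequential projective measurements of `±1`-valued observables -/

section Sequential

variable {H : Type*} [NormedAddCommGroup H] [InnerProductSpace ℂ H] [CompleteSpace H]

/-- A `±1`-valued projective observable: a self-adjoint operator `A` with `A² = 1`. -/
def IsDichotomic (A : H →L[ℂ] H) : Prop :=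
  IsSelfAdjoint A ∧ A * A = 1

/-- The projection `(1 + a A) / 2` onto the outcome `a = ±1` of a dichotomic observable `A`.
Outcomes are elements of `ℤˣ = {1, -1}`. -/
def outcomeProj (A : H →L[ℂ] H) (a : ℤˣ) : H →L[ℂ] H :=
  (1 / 2 : ℂ) • (1 + ((a : ℤ) : ℂ) • A)

/-- `P(a, b | A, B)`: the joint probability of the outcomes `a`, `b` when first `A` and then `B`
is measured on the state `ψ`. -/
def seqProb₂ (A B : H →L[ℂ] H) (ψ : H) (a b : ℤˣ) : ℝ :=
  ‖outcomeProj B b (outcomeProj A a ψ)‖ ^ 2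

/-- `P(a, b, c | A, B, C)`: the joint probability of the outcomes `a`, `b`, `c` when `A`, then `B`,
then `C` is measured on the state `ψ`. -/
def seqProb₃ (A B C : H →L[ℂ] H) (ψ : H) (a b c : ℤˣ) : ℝ :=
  ‖outcomeProj C c (outcomeProj B b (outcomeProj A a ψ))‖ ^ 2

/-- The sequential correlation of the measurement sequence `A → B`. -/
def seqCorr₂ (A B : H →L[ℂ] H) (ψ : H) : ℝ :=
  ∑ a : ℤˣ, ∑ b : ℤˣ, ((a : ℤ) : ℝ) * ((b : ℤ) : ℝ) * seqProb₂ A B ψ a b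

/-- The sequential correlation of the measurement sequence `A → B → C`. -/
def seqCorr₃ (A B C : H →L[ℂ] H) (ψ : H) : ℝ :=
  ∑ a : ℤˣ, ∑ b : ℤˣ, ∑ c : ℤˣ,
    ((a : ℤ) : ℝ) * ((b : ℤ) : ℝ) * ((c : ℤ) : ℝ) * seqProb₃ A B C ψ a b c

/-- The value of the temporal expression `I_T`. The observables `A₁, …, A₆` are `A 0, …, A 5`. -/
def temporalValue (A : Fin 6 → H →L[ℂ] H) (ψ : H) : ℝ :=
  (1 / 2) * (seqCorr₃ (A 0) (A 1) (A 2) ψ + seqCorr₃ (A 1) (A 0) (A 2) ψ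
      + seqCorr₃ (A 3) (A 4) (A 5) ψ + seqCorr₃ (A 4) (A 3) (A 5) ψ)
    + seqCorr₂ (A 0) (A 3) ψ + seqCorr₂ (A 1) (A 4) ψ - seqCorr₂ (A 2) (A 5) ψ

end Sequential

/-! ### The ideal two-qubit realization -/

/-- The two-qubit space `ℂ² ⊗ ℂ²`, in its product basis `|j k⟩`, with the Euclidean norm. -/
abbrev TwoQubit : Type := EuclideanSpace ℂ (Fin 2 × Fin 2)

def pauliX : Matrix (Fin 2) (Fin 2) ℂ := !![0, 1; 1, 0]

def pauliZ : Matrix (Fin 2) (Fin 2) ℂ := !![1, 0; 0, -1]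

/-- The ideal observables `A₁ = X ⊗ 1`, `A₂ = 1 ⊗ Z`, `A₃ = X ⊗ Z`, `A₄ = 1 ⊗ X`, `A₅ = Z ⊗ 1`,
`A₆ = Z ⊗ X`, as matrices. -/
def idealMatrix : Fin 6 → Matrix (Fin 2 × Fin 2) (Fin 2 × Fin 2) ℂ :=
  ![pauliX ⊗ₖ 1, 1 ⊗ₖ pauliZ, pauliX ⊗ₖ pauliZ, 1 ⊗ₖ pauliX, pauliZ ⊗ₖ 1, pauliZ ⊗ₖ pauliX]

/-- The ideal observables as operators on the two-qubit space. -/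
def idealObs (i : Fin 6) : TwoQubit →L[ℂ] TwoQubit :=
  Matrix.toEuclideanCLM (𝕜 := ℂ) (idealMatrix i)

/-- The maximally entangled state `(|00⟩ + |11⟩) / √2`. -/
def phiPlus : TwoQubit :=
  WithLp.toLp 2 (fun p => if p.1 = p.2 then ((1 / Real.sqrt 2 : ℝ) : ℂ) else 0)

end

/-! For `±1`-valued observables and a unit state, every sequential correlation is `1` minus a
weighted sum of squared distances between vectors such as `A₃ ψ` and `A₁ A₂ ψ`. So `5 - I_T` is a
sum of squares, and a deficit `ε` makes each relation of the ideal model hold on `ψ` up to `4√ε`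
(`approx_relations_of_temporalValue`).

The sign in `A₃ ψ ≈ -A₆ ψ` conflicts with `A₁ ψ ≈ A₄ ψ` and `A₂ ψ ≈ A₅ ψ`, which makes `ψ, A₁ψ, A₂ψ,
A₃ψ` almost orthonormal (`norm_inner_le_of_approx_neg`). The relations also show that all six
observables permute these vectors up to sign and an error `O(√ε)`, as the ideal ones permute the
Bell basis. Gram–Schmidt gives an exact orthonormal quadruple, and the isometry `W` from the Bell
basis onto it almost intertwines the two actions.

Gram–Schmidt keeps `ψ` as first vector, so `W† ψ = φ⁺` exactly: `P = W†` and `U = 1` give fidelity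
`1`, and the operator error is `O(√ε)`. -/

noncomputable section

/-! ### Sequential correlations as squared distances -/

section Correlations

variable {H : Type*} [NormedAddCommGroup H] [InnerProductSpace ℂ H]

theorem outcomeProj_one_apply (A : H →L[ℂ] H) (x : H) :
    outcomeProj A 1 x = (1 / 2 : ℂ) • (x + A x) := by
  simp [outcomeProj]

theorem outcomeProj_neg_one_apply (A : H →L[ℂ] H) (x : H) :
    outcomeProj A (-1) x = (1 / 2 : ℂ) • (x - A x) := by
  simp [outcomeProj, sub_eq_add_neg]

/-- The mean value of a `±1`-valued measurement. -/
theorem norm_outcomeProj_sq_sub (A : H →L[ℂ] H) (x : H) :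
    ‖outcomeProj A 1 x‖ ^ 2 - ‖outcomeProj A (-1) x‖ ^ 2 = (inner ℂ x (A x)).re := by
  rw [outcomeProj_one_apply, outcomeProj_neg_one_apply, norm_smul, norm_smul, mul_pow, mul_pow,
    @norm_add_sq ℂ, @norm_sub_sq ℂ]
  norm_num
  ring

/-- The mean value of `C` weighted by the outcome of a preceding measurement of `A`. -/
theorem re_inner_outcomeProj_sub (A C : H →L[ℂ] H) (x : H) :
    (inner ℂ (outcomeProj A 1 x) (C (outcomeProj A 1 x))).re
      - (inner ℂ (outcomeProj A (-1) x) (C (outcomeProj A (-1) x))).re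
      = 1 / 2 * ((inner ℂ x (C (A x))).re + (inner ℂ (A x) (C x)).re) := by
  rw [outcomeProj_one_apply, outcomeProj_neg_one_apply, ← Complex.sub_re]
  simp only [map_smul, map_add, map_sub, inner_smul_left, inner_smul_right, inner_add_left,
    inner_add_right, inner_sub_left, inner_sub_right]
  rw [← Complex.add_re, show (1 / 2 : ℝ) = ((1 / 2 : ℝ)) from rfl, ← Complex.re_ofReal_mul]
  congr 1
  simp [map_ofNat]
  ring

theorem seqCorr₂_eq (A B : H →L[ℂ] H) (x : H) :
    seqCorr₂ A B x = 1 / 2 * ((inner ℂ x (B (A x))).re + (inner ℂ (A x) (B x)).re) := by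
  rw [← re_inner_outcomeProj_sub, ← norm_outcomeProj_sq_sub, ← norm_outcomeProj_sq_sub]
  simp [seqCorr₂, seqProb₂, UnitsInt.univ]
  ring

theorem re_inner_eq_one_sub_norm_sub_sq {x y : H} (hx : ‖x‖ = 1) (hy : ‖y‖ = 1) :
    (inner ℂ x y).re = 1 - ‖x - y‖ ^ 2 / 2 := by
  have := @norm_sub_sq ℂ _ _ _ _ x y
  rw [hx, hy] at this
  simp only [RCLike.re_to_complex] at this
  linarith

variable [CompleteSpace H]

theorem IsDichotomic.apply_apply {A : H →L[ℂ] H} (hA : IsDichotomic A) (x : H) :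
    A (A x) = x := by
  have := congrArg (fun T : H →L[ℂ] H => T x) hA.2
  simpa using this

theorem IsDichotomic.inner_left {A : H →L[ℂ] H} (hA : IsDichotomic A) (x y : H) :
    inner ℂ (A x) y = inner ℂ x (A y) := by
  have h := ContinuousLinearMap.adjoint_inner_right A x y
  rw [← ContinuousLinearMap.star_eq_adjoint, hA.1.star_eq] at h
  exact h.symm

theorem IsDichotomic.norm_apply {A : H →L[ℂ] H} (hA : IsDichotomic A) (x : H) :
    ‖A x‖ = ‖x‖ := by
  have h : (inner ℂ (A x) (A x) : ℂ) = inner ℂ x x := by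
    rw [hA.inner_left, hA.apply_apply]
  rw [inner_self_eq_norm_sq_to_K, inner_self_eq_norm_sq_to_K] at h
  have h' : ‖A x‖ ^ 2 = ‖x‖ ^ 2 := by exact_mod_cast h
  exact (pow_left_inj₀ (norm_nonneg _) (norm_nonneg _) two_ne_zero).1 h'

theorem IsDichotomic.norm_apply_sub {A : H →L[ℂ] H} (hA : IsDichotomic A) (x y : H) :
    ‖A x - A y‖ = ‖x - y‖ := by
  rw [← map_sub, hA.norm_apply]

/-- Summing over the last outcome leaves the mean of `C`; each earlier measurement then symmetrizes.
The result is the mean of a nested anticommutator, `{A, {B, C}} / 4`. -/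
theorem seqCorr₃_eq (A : H →L[ℂ] H) {B : H →L[ℂ] H} (hB : IsDichotomic B) (C : H →L[ℂ] H)
    (x : H) :
    seqCorr₃ A B C x = 1 / 4 * ((inner ℂ x (C (B (A x)))).re + (inner ℂ (A x) (C (B x))).re
      + (inner ℂ x (B (C (A x)))).re + (inner ℂ (A x) (B (C x))).re) := by
  have h1 := re_inner_outcomeProj_sub A (C ∘L B) x
  have h2 := re_inner_outcomeProj_sub A (B ∘L C) x
  have h3 := re_inner_outcomeProj_sub B C (outcomeProj A 1 x)
  have h4 := re_inner_outcomeProj_sub B C (outcomeProj A (-1) x)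
  simp only [ContinuousLinearMap.comp_apply] at h1 h2
  rw [hB.inner_left] at h3 h4
  simp only [← norm_outcomeProj_sq_sub] at h3 h4
  have h : seqCorr₃ A B C x =
      (‖outcomeProj C 1 (outcomeProj B 1 (outcomeProj A 1 x))‖ ^ 2
      - ‖outcomeProj C (-1) (outcomeProj B 1 (outcomeProj A 1 x))‖ ^ 2
      - (‖outcomeProj C 1 (outcomeProj B (-1) (outcomeProj A 1 x))‖ ^ 2
      - ‖outcomeProj C (-1) (outcomeProj B (-1) (outcomeProj A 1 x))‖ ^ 2))
      - (‖outcomeProj C 1 (outcomeProj B 1 (outcomeProj A (-1) x))‖ ^ 2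
      - ‖outcomeProj C (-1) (outcomeProj B 1 (outcomeProj A (-1) x))‖ ^ 2
      - (‖outcomeProj C 1 (outcomeProj B (-1) (outcomeProj A (-1) x))‖ ^ 2
      - ‖outcomeProj C (-1) (outcomeProj B (-1) (outcomeProj A (-1) x))‖ ^ 2)) := by
    simp [seqCorr₃, seqProb₃, UnitsInt.univ]
    ring
  rw [h, h3, h4]
  linarith

theorem seqCorr₂_eq_one_sub {A B : H →L[ℂ] H} (hA : IsDichotomic A) (hB : IsDichotomic B)
    {x : H} (hx : ‖x‖ = 1) : seqCorr₂ A B x = 1 - ‖A x - B x‖ ^ 2 / 2 := by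
  rw [seqCorr₂_eq, ← hB.inner_left, ← re_inner_eq_one_sub_norm_sub_sq
    (by rw [hA.norm_apply, hx]) (by rw [hB.norm_apply, hx]), ← inner_conj_symm (B x) (A x),
    Complex.conj_re]
  ring

theorem seqCorr₃_eq_one_sub {A B C : H →L[ℂ] H} (hA : IsDichotomic A) (hB : IsDichotomic B)
    (hC : IsDichotomic C) {x : H} (hx : ‖x‖ = 1) :
    seqCorr₃ A B C x = 1 - (‖C x - B (A x)‖ ^ 2 + ‖A x - C (B x)‖ ^ 2
      + ‖B x - C (A x)‖ ^ 2 + ‖A x - B (C x)‖ ^ 2) / 8 := by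
  rw [seqCorr₃_eq A hB, ← hC.inner_left x, ← hB.inner_left x]
  iterate 4 rw [re_inner_eq_one_sub_norm_sub_sq (by simp [hA.norm_apply, hB.norm_apply,
    hC.norm_apply, hx]) (by simp [hA.norm_apply, hB.norm_apply, hC.norm_apply, hx])]
  ring

end Correlations

/-! ### Gram–Schmidt with estimates, and extension of a unit vector to an orthonormal quadruple -/

section Extension

variable {H : Type*} [NormedAddCommGroup H] [InnerProductSpace ℂ H]

theorem orthonormal_snoc {n : ℕ} {e : Fin n → H} (he : Orthonormal ℂ e) {f : H} (hf : ‖f‖ = 1)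
    (h : ∀ i, inner ℂ (e i) f = 0) : Orthonormal ℂ (Fin.snoc e f : Fin (n + 1) → H) := by
  refine ⟨fun i => ?_, fun i j hij => ?_⟩
  · refine Fin.lastCases ?_ (fun i => ?_) i
    · simpa using hf
    · simpa using he.1 i
  · induction i using Fin.lastCases with
    | last =>
      induction j using Fin.lastCases with
      | last => exact absurd rfl hij
      | cast j => simpa using inner_eq_zero_symm.1 (h j)
    | cast i =>
      induction j using Fin.lastCases with
      | last => simpa using h i
      | cast j =>
        simpa using he.2 (fun hh => hij (by rw [hh]))

/-- One step of the Gram–Schmidt process, with an estimate. -/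
theorem exists_unit_orthogonal_near {n : ℕ} {e : Fin n → H} (he : Orthonormal ℂ e) {v : H}
    (hv : ‖v‖ = 1) {η : ℝ} (h : ∀ i, ‖inner ℂ (e i) v‖ ≤ η) (hη : n * η < 1) :
    ∃ f : H, ‖f‖ = 1 ∧ (∀ i, inner ℂ (e i) f = 0) ∧ ‖f - v‖ ≤ 2 * (n * η) := by
  set w : H := v - ∑ i, (inner ℂ (e i) v : ℂ) • e i with hw
  have hwv : ‖w - v‖ ≤ n * η := by
    have : w - v = -∑ i, (inner ℂ (e i) v : ℂ) • e i := by rw [hw]; abel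
    rw [this, norm_neg]
    refine (norm_sum_le _ _).trans ?_
    calc ∑ i, ‖(inner ℂ (e i) v : ℂ) • e i‖ ≤ ∑ _i : Fin n, η :=
          Finset.sum_le_sum fun i _ => by rw [norm_smul, he.1 i, mul_one]; exact h i
      _ = n * η := by simp
  have hdist : |‖w‖ - 1| ≤ n * η := by
    rw [← hv]; exact (abs_norm_sub_norm_le w v).trans hwv
  have hpos : 0 < ‖w‖ := by have := (abs_le.1 hdist).1; linarith
  have hne : (‖w‖ : ℂ) ≠ 0 := by exact_mod_cast hpos.ne'
  refine ⟨((‖w‖ : ℂ)⁻¹) • w, ?_, fun i => ?_, ?_⟩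
  · rw [norm_smul, norm_inv, Complex.norm_real, norm_norm, inv_mul_cancel₀ hpos.ne']
  · rw [inner_smul_right, hw, inner_sub_right, he.inner_right_fintype, sub_self, mul_zero]
  · have h1 : ((‖w‖ : ℂ)⁻¹) • w - w = ((‖w‖ : ℂ)⁻¹ * ((1 - ‖w‖ : ℝ) : ℂ)) • w := by
      rw [Complex.ofReal_sub, mul_sub, sub_smul, inv_mul_cancel₀ hne]
      simp
    have h2 : ‖((‖w‖ : ℂ)⁻¹) • w - w‖ ≤ n * η := by
      rw [h1, norm_smul, norm_mul, norm_inv, Complex.norm_real, norm_norm, Complex.norm_real,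
        mul_right_comm, inv_mul_cancel₀ hpos.ne', one_mul, Real.norm_eq_abs, abs_sub_comm]
      exact hdist
    calc _ ≤ ‖((‖w‖ : ℂ)⁻¹) • w - w‖ + ‖w - v‖ := norm_sub_le_norm_sub_add_norm_sub _ _ _
      _ ≤ _ := by linarith

theorem exists_unit_orthogonal_of_lt_rank {n : ℕ} (hn : (n : Cardinal) < Module.rank ℂ H)
    (e : Fin n → H) : ∃ f : H, ‖f‖ = 1 ∧ ∀ i, inner ℂ (e i) f = 0 := by
  have hne : (Submodule.span ℂ (Set.range e))ᗮ ≠ ⊥ := by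
    intro hbot
    have : FiniteDimensional ℂ (Submodule.span ℂ (Set.range e)) :=
      FiniteDimensional.span_of_finite ℂ (Set.finite_range e)
    rw [Submodule.orthogonal_eq_bot_iff] at hbot
    have h1 := rank_span_le (R := ℂ) (Set.range e)
    rw [hbot, rank_top] at h1
    have h2 : Cardinal.mk (Set.range e) ≤ n := by
      simpa using Cardinal.mk_range_le_lift (f := e)
    exact absurd (h1.trans h2) (not_le.2 hn)
  obtain ⟨w, hw, hw0⟩ := Submodule.exists_mem_ne_zero_of_ne_bot hne
  refine ⟨((‖w‖ : ℂ)⁻¹) • w, ?_, fun i => ?_⟩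
  · simp [norm_smul, hw0]
  · rw [inner_smul_right, (Submodule.mem_orthogonal _ _).1 hw _
      (Submodule.subset_span (Set.mem_range_self i)), mul_zero]

theorem exists_orthonormal_of_le_rank (h : 4 ≤ Module.rank ℂ H) {x : H} (hx : ‖x‖ = 1) :
    ∃ e : Fin 4 → H, Orthonormal ℂ e ∧ e 0 = x := by
  have key : ∀ n : ℕ, n < 4 → ∃ e : Fin (n + 1) → H, Orthonormal ℂ e ∧ e 0 = x := by
    intro n
    induction n with
    | zero =>
      intro _
      exact ⟨fun _ => x, ⟨fun _ => hx, fun i j hij => absurd (Subsingleton.elim (α := Fin 1) i j) hij⟩, rfl⟩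
    | succ n ih =>
      intro hn
      obtain ⟨e, he, he0⟩ := ih (by omega)
      have hlt : ((n + 1 : ℕ) : Cardinal) < Module.rank ℂ H :=
        lt_of_lt_of_le (by exact_mod_cast hn) h
      obtain ⟨f, hf, hef⟩ := exists_unit_orthogonal_of_lt_rank hlt e
      refine ⟨Fin.snoc e f, orthonormal_snoc he hf hef, ?_⟩
      rw [← he0, ← Fin.castSucc_zero, Fin.snoc_castSucc]
  exact key 3 (by norm_num)

/-- A quadruple of unit vectors that is almost orthonormal is close to an orthonormal one with the
same first vector. -/
theorem exists_orthonormal_near {v : Fin 4 → H} (hv : ∀ i, ‖v i‖ = 1) {η : ℝ}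
    (hvv : ∀ i j, i < j → ‖inner ℂ (v i) (v j)‖ ≤ η) (hη : 39 * η < 1) :
    ∃ e : Fin 4 → H, Orthonormal ℂ e ∧ e 0 = v 0 ∧ ∀ i, ‖e i - v i‖ ≤ 78 * η := by
  have h0 : 0 ≤ η := (norm_nonneg _).trans (hvv 0 1 (by decide))
  have pert : ∀ (i j : Fin 4) (f : H) (c : ℝ), i < j → ‖f - v i‖ ≤ c →
      ‖inner ℂ f (v j)‖ ≤ c + η := by
    intro i j f c hij hf
    have : (inner ℂ f (v j) : ℂ) = inner ℂ (f - v i) (v j) + inner ℂ (v i) (v j) := by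
      rw [← inner_add_left, sub_add_cancel]
    rw [this]
    refine (norm_add_le _ _).trans (add_le_add ((norm_inner_le_norm _ _).trans ?_) (hvv i j hij))
    rwa [hv, mul_one]
  have o1 : Orthonormal ℂ (fun _ : Fin 1 => v 0) :=
    ⟨fun _ => hv 0, fun i j hij => absurd (Subsingleton.elim (α := Fin 1) i j) hij⟩
  obtain ⟨e1, n1, p1, d1⟩ := exists_unit_orthogonal_near o1 (hv 1)
    (fun _ => hvv 0 1 (by decide)) (by push_cast; linarith)
  have o2 := orthonormal_snoc o1 n1 p1
  have q0 := fun (j : Fin 4) (hj : 0 < j) => pert 0 j (v 0) 0 hj (by simp)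
  push_cast at d1
  -- Overlaps with the corrected vectors grow by their displacement: `2η + η = 3η` here, then
  -- `2·2·3η + η = 13η`. The last step needs `3·13η < 1` and moves its vector by at most `78η`.
  obtain ⟨e2, n2, p2, d2⟩ := exists_unit_orthogonal_near (η := 3 * η) o2 (hv 2)
    (Fin.lastCases (by
      rw [Fin.snoc_last]; exact (pert 1 2 e1 _ (by decide) d1).trans (by linarith))
      (fun i => by simpa using (q0 2 (by decide)).trans (by linarith)))
    (by push_cast; linarith)
  have o3 := orthonormal_snoc o2 n2 p2
  push_cast at d2
  obtain ⟨e3, n3, p3, d3⟩ := exists_unit_orthogonal_near (η := 13 * η) o3 (hv 3)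
    (Fin.lastCases (by
      rw [Fin.snoc_last]; exact (pert 2 3 e2 _ (by decide) d2).trans (by linarith))
      (Fin.lastCases (by
      rw [Fin.snoc_castSucc, Fin.snoc_last]
      exact (pert 1 3 e1 _ (by decide) d1).trans (by linarith))
      (fun i => by simpa using (q0 3 (by decide)).trans (by linarith))))
    (by push_cast; linarith)
  have o4 := orthonormal_snoc o3 n3 p3
  push_cast at d3
  refine ⟨_, o4, rfl, Fin.lastCases ?_ (Fin.lastCases ?_ (Fin.lastCases ?_ ?_))⟩
  · rw [Fin.snoc_last]
    exact d3.trans (by linarith)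
  · rw [Fin.snoc_castSucc, Fin.snoc_last]
    exact d2.trans (by linarith)
  · rw [Fin.snoc_castSucc, Fin.snoc_castSucc, Fin.snoc_last]
    exact d1.trans (by linarith)
  · intro i
    rw [Fin.snoc_castSucc, Fin.snoc_castSucc, Fin.snoc_castSucc, Subsingleton.elim i 0]
    simpa using h0

end Extension

/-! ### The ideal observables as signed permutations of the Bell basis -/

section Ideal

/-- The Bell basis `φ⁺`, `A₁ φ⁺`, `A₂ φ⁺`, `A₃ φ⁺`, where `Aᵢ` are the ideal observables. -/
def bellVector : Fin 4 → TwoQubit :=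
  ![phiPlus, idealObs 0 phiPlus, idealObs 1 phiPlus, idealObs 2 phiPlus]

/-- The ideal observables permute the Bell basis, up to the signs `idealSign`. -/
def idealPerm : Fin 6 → Fin 4 → Fin 4 :=
  ![![1, 0, 3, 2], ![2, 3, 0, 1], ![3, 2, 1, 0], ![1, 0, 3, 2], ![2, 3, 0, 1], ![3, 2, 1, 0]]

def idealSign : Fin 6 → Fin 4 → ℤˣ :=
  ![![1, 1, 1, 1], ![1, 1, 1, 1], ![1, 1, 1, 1], ![1, 1, -1, -1], ![1, -1, 1, -1],
    ![-1, 1, 1, -1]]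

theorem idealObs_apply (i : Fin 6) (x : TwoQubit) (p : Fin 2 × Fin 2) :
    idealObs i x p = ∑ q, idealMatrix i p q * x q := rfl

theorem idealObs_bellVector (i : Fin 6) (k : Fin 4) :
    idealObs i (bellVector k) = ((idealSign i k : ℤ) : ℂ) • bellVector (idealPerm i k) := by
  ext ⟨p, q⟩
  rw [PiLp.smul_apply]
  fin_cases i <;> fin_cases k <;> fin_cases p <;> fin_cases q <;>
    simp [bellVector, idealObs_apply, idealMatrix, pauliX, pauliZ, phiPlus, idealSign, idealPerm,
      Fintype.sum_prod_type, Matrix.kroneckerMap_apply, Matrix.one_apply]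

theorem orthonormal_bellVector : Orthonormal ℂ bellVector := by
  have h : ((|Real.sqrt 2| : ℝ) : ℂ) ^ 2 = 2 := by
    rw [← Complex.ofReal_pow, sq_abs, Real.sq_sqrt (by norm_num)]; norm_num
  rw [orthonormal_iff_ite]
  intro i j
  rw [PiLp.inner_apply]
  fin_cases i <;> fin_cases j <;>
    simp [bellVector, idealObs_apply, idealMatrix, pauliX, pauliZ, phiPlus,
      Fintype.sum_prod_type, Matrix.kroneckerMap_apply, Matrix.one_apply, h] <;> norm_num

def bellBasis : OrthonormalBasis (Fin 4) ℂ TwoQubit :=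
  OrthonormalBasis.mk orthonormal_bellVector (by
    rw [orthonormal_bellVector.linearIndependent.span_eq_top_of_card_eq_finrank (by simp)])

theorem bellBasis_apply (k : Fin 4) : bellBasis k = bellVector k := by
  simp [bellBasis]

theorem norm_intCast_units (s : ℤˣ) : ‖((s : ℤ) : ℂ)‖ = 1 := by
  rcases Int.units_eq_one_or s with rfl | rfl <;> simp

end Ideal

/-! ### Isometric embeddings and compressions -/

section Isometry

variable {H : Type*} [NormedAddCommGroup H] [InnerProductSpace ℂ H]

/-- A linear map on the two-qubit space is bounded by its values on the Bell basis. -/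
theorem opNorm_le_of_bellVector (T : TwoQubit →L[ℂ] H) {c : ℝ}
    (h : ∀ k, ‖T (bellVector k)‖ ≤ c) : ‖T‖ ≤ 4 * c := by
  have hc : 0 ≤ c := (norm_nonneg _).trans (h 0)
  refine T.opNorm_le_bound (by linarith) fun x => ?_
  conv_lhs => rw [← bellBasis.sum_repr' x, map_sum]
  calc ‖∑ k, T ((inner ℂ (bellBasis k) x : ℂ) • bellBasis k)‖
      ≤ ∑ _k : Fin 4, ‖x‖ * c := by
        refine norm_sum_le_of_le _ fun k _ => ?_
        rw [map_smul, norm_smul, bellBasis_apply]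
        refine mul_le_mul ?_ (h k) (norm_nonneg _) (norm_nonneg _)
        have := norm_inner_le_norm (𝕜 := ℂ) (bellVector k) x
        rwa [orthonormal_bellVector.1 k, one_mul] at this
    _ = 4 * c * ‖x‖ := by simp; ring

variable [CompleteSpace H]

theorem exists_isometry_bellVector {e : Fin 4 → H} (he : Orthonormal ℂ e) :
    ∃ W : TwoQubit →L[ℂ] H, ContinuousLinearMap.adjoint W ∘L W = 1 ∧
      ∀ k, W (bellVector k) = e k := by
  let L : TwoQubit →ₗ[ℂ] H := bellBasis.toBasis.constr ℂ e
  have hL : ∀ k, L (bellVector k) = e k := fun k => by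
    rw [← bellBasis_apply, ← OrthonormalBasis.coe_toBasis, Module.Basis.constr_basis]
  have hLe : L ∘ bellBasis.toBasis = e := by
    ext k
    simp only [Function.comp_apply, OrthonormalBasis.coe_toBasis, bellBasis_apply, hL]
  let I : TwoQubit →ₗᵢ[ℂ] H := L.isometryOfOrthonormal (v := bellBasis.toBasis)
    (by simp) (by rw [hLe]; exact he)
  refine ⟨I.toContinuousLinearMap, ?_, hL⟩
  rw [← ContinuousLinearMap.norm_map_iff_adjoint_comp_self]
  exact fun x => I.norm_map x

theorem ContinuousLinearMap.norm_le_one_of_adjoint_comp_self {W : TwoQubit →L[ℂ] H}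
    (hW : ContinuousLinearMap.adjoint W ∘L W = 1) : ‖W‖ ≤ 1 :=
  W.opNorm_le_bound zero_le_one fun x => by
    rw [(ContinuousLinearMap.norm_map_iff_adjoint_comp_self W).2 hW x, one_mul]

/-- Since `W† W = 1`, the difference equals `W† (B W - W Aᵢ)` with `Aᵢ` ideal, so approximate
intertwining on the Bell basis suffices; the range of `W` need not be invariant under `B`. -/
theorem norm_compression_sub_idealObs_le {W : TwoQubit →L[ℂ] H}
    (hW : ContinuousLinearMap.adjoint W ∘L W = 1) (B : H →L[ℂ] H) (i : Fin 6) {c : ℝ}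
    (h : ∀ k, ‖B (W (bellVector k))
      - ((idealSign i k : ℤ) : ℂ) • W (bellVector (idealPerm i k))‖ ≤ c) :
    ‖ContinuousLinearMap.adjoint W ∘L B ∘L W - idealObs i‖ ≤ 4 * c := by
  have key : ContinuousLinearMap.adjoint W ∘L B ∘L W - idealObs i
      = ContinuousLinearMap.adjoint W ∘L (B ∘L W - W ∘L idealObs i) := by
    rw [ContinuousLinearMap.comp_sub, ← ContinuousLinearMap.comp_assoc _ W, hW]
    rfl
  rw [key]
  refine (ContinuousLinearMap.opNorm_comp_le _ _).trans ?_
  have h1 : ‖ContinuousLinearMap.adjoint W‖ ≤ 1 := by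
    rw [LinearIsometryEquiv.norm_map]
    exact ContinuousLinearMap.norm_le_one_of_adjoint_comp_self hW
  refine (mul_le_of_le_one_left (norm_nonneg _) h1).trans (opNorm_le_of_bellVector _ fun k => ?_)
  rw [sub_apply, ContinuousLinearMap.comp_apply, ContinuousLinearMap.comp_apply,
    idealObs_bellVector, map_smul]
  exact h k

end Isometry

/-! ### From a near-maximal value to an approximate Bell-basis action -/

section Rigidity

variable {H : Type*} [NormedAddCommGroup H] [InnerProductSpace ℂ H] [CompleteSpace H]

/-- On the vector `x`, each of `a`, `b`, `c` is within `δ` of the product of the other two, in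
either order. -/
structure IsApproxTriple (a b c : H →L[ℂ] H) (x : H) (δ : ℝ) : Prop where
  a_bc : ‖a x - b (c x)‖ ≤ δ
  a_cb : ‖a x - c (b x)‖ ≤ δ
  b_ac : ‖b x - a (c x)‖ ≤ δ
  b_ca : ‖b x - c (a x)‖ ≤ δ
  c_ab : ‖c x - a (b x)‖ ≤ δ
  c_ba : ‖c x - b (a x)‖ ≤ δ

theorem le_four_mul_sqrt {q ε : ℝ} (hε : 0 ≤ ε) (h : q ^ 2 ≤ 16 * ε) : q ≤ 4 * √ε := by
  refine (le_abs_self q).trans (abs_le_of_sq_le_sq ?_ (by positivity))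
  rw [mul_pow, Real.sq_sqrt hε]
  linarith

/-- The temporal expression is at most `5`, and near its maximum the observables nearly satisfy the
algebraic relations of the ideal ones on the state. -/
theorem approx_relations_of_temporalValue {A : Fin 6 → H →L[ℂ] H} {x : H} {ε : ℝ}
    (hA : ∀ i, IsDichotomic (A i)) (hx : ‖x‖ = 1) (h : temporalValue A x = 5 - ε) :
    0 ≤ ε ∧ IsApproxTriple (A 0) (A 1) (A 2) x (4 * √ε) ∧
      IsApproxTriple (A 3) (A 4) (A 5) x (4 * √ε) ∧ ‖A 0 x - A 3 x‖ ≤ 4 * √ε ∧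
      ‖A 1 x - A 4 x‖ ≤ 4 * √ε ∧ ‖A 2 x + A 5 x‖ ≤ 4 * √ε := by
  have hp : ‖A 2 x - A 5 x‖ ^ 2 = 4 - ‖A 2 x + A 5 x‖ ^ 2 := by
    have := parallelogram_law_with_norm ℂ (A 2 x) (A 5 x)
    rw [(hA 2).norm_apply, (hA 5).norm_apply, hx] at this
    linarith
  rw [temporalValue, seqCorr₃_eq_one_sub (hA 0) (hA 1) (hA 2) hx,
    seqCorr₃_eq_one_sub (hA 1) (hA 0) (hA 2) hx, seqCorr₃_eq_one_sub (hA 3) (hA 4) (hA 5) hx,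
    seqCorr₃_eq_one_sub (hA 4) (hA 3) (hA 5) hx, seqCorr₂_eq_one_sub (hA 0) (hA 3) hx,
    seqCorr₂_eq_one_sub (hA 1) (hA 4) hx, seqCorr₂_eq_one_sub (hA 2) (hA 5) hx, hp] at h
  have hsq := fun y : H => sq_nonneg ‖y‖
  have h1 := hsq (A 0 x - A 1 (A 2 x))
  have h2 := hsq (A 0 x - A 2 (A 1 x))
  have h3 := hsq (A 1 x - A 0 (A 2 x))
  have h4 := hsq (A 1 x - A 2 (A 0 x))
  have h5 := hsq (A 2 x - A 0 (A 1 x))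
  have h6 := hsq (A 2 x - A 1 (A 0 x))
  have k1 := hsq (A 3 x - A 4 (A 5 x))
  have k2 := hsq (A 3 x - A 5 (A 4 x))
  have k3 := hsq (A 4 x - A 3 (A 5 x))
  have k4 := hsq (A 4 x - A 5 (A 3 x))
  have k5 := hsq (A 5 x - A 3 (A 4 x))
  have k6 := hsq (A 5 x - A 4 (A 3 x))
  have l1 := hsq (A 0 x - A 3 x)
  have l2 := hsq (A 1 x - A 4 x)
  have l3 := hsq (A 2 x + A 5 x)
  have hε : 0 ≤ ε := by linarith
  -- Each square enters the deficit with weight at least `1/2 · 1/8 = 1/16`, hence the bound `16 ε`.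
  refine ⟨hε, ⟨?_, ?_, ?_, ?_, ?_, ?_⟩, ⟨?_, ?_, ?_, ?_, ?_, ?_⟩, ?_, ?_, ?_⟩ <;>
    refine le_four_mul_sqrt hε ?_ <;> linarith

/-- If `a y ≈ z` and `d y' ≈ z'`, where `a x ≈ d x` and `y ≈ y'` but `z ≈ -z'`, then `x` and `z`,
and `a x` and `y`, are almost orthogonal. -/
theorem norm_inner_le_of_approx_neg {a d : H →L[ℂ] H} (ha : IsDichotomic a) (hd : IsDichotomic d)
    {x y z y' z' : H} (hx : ‖x‖ = 1) (hy : ‖y‖ = 1) {δ : ℝ} (had : ‖a x - d x‖ ≤ δ)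
    (hyy : ‖y - y'‖ ≤ δ) (hzz : ‖z + z'‖ ≤ δ) (hz : ‖z - a y‖ ≤ δ) (hz' : ‖z' - d y'‖ ≤ δ) :
    ‖(inner ℂ x z : ℂ)‖ ≤ 4 * δ ∧ ‖(inner ℂ (a x) y : ℂ)‖ ≤ 4 * δ := by
  have hδ : 0 ≤ δ := (norm_nonneg _).trans had
  have bound : ∀ {p q : H} {c : ℝ}, ‖p‖ = 1 → ‖q‖ ≤ c → ‖(inner ℂ p q : ℂ)‖ ≤ c := by
    intro p q c hp hq
    have := norm_inner_le_norm (𝕜 := ℂ) p q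
    rw [hp, one_mul] at this
    exact this.trans hq
  have h1 := bound hx hz
  have h2 := bound hx hz'
  have h3 := bound hx hzz
  have h4 := bound (p := d x) (by rw [hd.norm_apply, hx]) hyy
  have h5 := bound hy had
  rw [norm_inner_symm] at h5
  rw [inner_sub_right, ← ha.inner_left] at h1
  rw [inner_sub_right, ← hd.inner_left] at h2
  rw [inner_add_right] at h3
  rw [inner_sub_right] at h4
  rw [inner_sub_left] at h5
  generalize (inner ℂ x z : ℂ) = s at *
  generalize (inner ℂ x z' : ℂ) = s' at *
  generalize (inner ℂ (a x) y : ℂ) = t at *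
  generalize (inner ℂ (d x) y' : ℂ) = t' at *
  generalize (inner ℂ (d x) y : ℂ) = u at *
  -- The chain `s ≈ t ≈ u ≈ t' ≈ s' ≈ -s` has five links, each of length at most `δ`.
  have hs : ‖2 * s‖ ≤ 5 * δ := by
    rw [show 2 * s = (s - t) + (t - u) + (u - t') + (s + s') - (s' - t') by ring]
    refine (norm_sub_le _ _).trans ?_
    have := norm_add₄_le (a := s - t) (b := t - u) (c := u - t') (d := s + s')
    linarith
  have ht : ‖2 * t‖ ≤ 7 * δ := by
    rw [show 2 * t = 2 * s - (s - t) - (s - t) by ring]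
    have e1 := norm_sub_le (2 * s - (s - t)) (s - t)
    have e2 := norm_sub_le (2 * s) (s - t)
    linarith
  rw [norm_mul, Complex.norm_ofNat] at hs ht
  constructor <;> linarith

/-- The vectors `x`, `A₁ x`, `A₂ x`, `A₃ x`. -/
def stateVector (A : Fin 6 → H →L[ℂ] H) (x : H) : Fin 4 → H :=
  ![x, A 0 x, A 1 x, A 2 x]

theorem norm_stateVector {A : Fin 6 → H →L[ℂ] H} (hA : ∀ i, IsDichotomic (A i)) {x : H}
    (hx : ‖x‖ = 1) (k : Fin 4) : ‖stateVector A x k‖ = 1 := by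
  fin_cases k <;> simp [stateVector, (hA _).norm_apply, hx]

variable {A : Fin 6 → H →L[ℂ] H} {x : H} {δ : ℝ}

/-- Three instances of the sign conflict, with the minus sign moved to a different member of the
second triple when needed, each settle two of the six pairs. -/
theorem norm_inner_stateVector_le (hA : ∀ i, IsDichotomic (A i)) (hx : ‖x‖ = 1)
    (h : IsApproxTriple (A 0) (A 1) (A 2) x δ) (h' : IsApproxTriple (A 3) (A 4) (A 5) x δ)
    (h0 : ‖A 0 x - A 3 x‖ ≤ δ) (h1 : ‖A 1 x - A 4 x‖ ≤ δ) (h2 : ‖A 2 x + A 5 x‖ ≤ δ)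
    (i j : Fin 4) (hij : i < j) :
    ‖(inner ℂ (stateVector A x i) (stateVector A x j) : ℂ)‖ ≤ 4 * δ := by
  have neg : ∀ (T : H →L[ℂ] H) (p q : H), ‖p - T q‖ ≤ δ → ‖-p - T (-q)‖ ≤ δ := by
    intro T p q hpq
    rwa [map_neg, ← neg_sub', norm_neg]
  have n : ∀ i, ‖A i x‖ = 1 := fun i => by rw [(hA i).norm_apply, hx]
  have r3 := norm_inner_le_of_approx_neg (hA 0) (hA 3) hx (n 1) h0 h1 h2 h.c_ab h'.c_ab
  have h2' : ‖A 2 x - -A 5 x‖ ≤ δ := by rwa [sub_neg_eq_add]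
  have r2 := norm_inner_le_of_approx_neg (hA 0) (hA 3) hx (n 2) h0 h2'
    (by rwa [← sub_eq_add_neg]) h.b_ac (neg _ _ _ h'.b_ac)
  have r1 := norm_inner_le_of_approx_neg (hA 1) (hA 4) hx (n 2) h1 h2'
    (by rwa [← sub_eq_add_neg]) h.a_bc (neg _ _ _ h'.a_bc)
  fin_cases i <;> fin_cases j <;>
    first
    | exact absurd hij (by decide)
    | exact r1.1
    | exact r2.1
    | exact r3.1
    | exact r3.2
    | exact r2.2
    | exact r1.2

/-- For the first triple this is one relation on `x`. For the second, `tri` trades the vector for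
its counterpart in the second triple, applies a relation there and trades back, at a cost of `δ`
each; the signs come from `A₃ x ≈ -A₆ x`. -/
theorem norm_apply_stateVector_sub_le (hA : ∀ i, IsDichotomic (A i))
    (h : IsApproxTriple (A 0) (A 1) (A 2) x δ) (h' : IsApproxTriple (A 3) (A 4) (A 5) x δ)
    (h0 : ‖A 0 x - A 3 x‖ ≤ δ) (h1 : ‖A 1 x - A 4 x‖ ≤ δ) (h2 : ‖A 2 x + A 5 x‖ ≤ δ)
    (i : Fin 6) (k : Fin 4) :
    ‖A i (stateVector A x k) - ((idealSign i k : ℤ) : ℂ) • stateVector A x (idealPerm i k)‖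
      ≤ 3 * δ := by
  have hδ : 0 ≤ δ := (norm_nonneg _).trans h0
  have pos : ∀ {s : ℤˣ} {p q : H}, s = 1 → ‖q - p‖ ≤ 3 * δ →
      ‖p - ((s : ℤ) : ℂ) • q‖ ≤ 3 * δ := by
    rintro s p q rfl hpq
    simpa [norm_sub_rev] using hpq
  have neg : ∀ {s : ℤˣ} {p q : H}, s = -1 → ‖-q - p‖ ≤ 3 * δ →
      ‖p - ((s : ℤ) : ℂ) • q‖ ≤ 3 * δ := by
    rintro s p q rfl hpq
    rw [norm_sub_rev] at hpq
    simpa using hpq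
  have tri : ∀ {i : Fin 6} {q q' p p' : H}, ‖q - q'‖ ≤ δ → ‖q' - A i p'‖ ≤ δ → ‖p - p'‖ ≤ δ →
      ‖q - A i p‖ ≤ 3 * δ := by
    intro i q q' p p' e1 e2 e3
    rw [norm_sub_rev, ← (hA i).norm_apply_sub] at e3
    have f1 := norm_sub_le_norm_sub_add_norm_sub q q' (A i p)
    have f2 := norm_sub_le_norm_sub_add_norm_sub q' (A i p') (A i p)
    linarith
  have one : ∀ {p q : H}, ‖q - p‖ ≤ δ → ‖q - p‖ ≤ 3 * δ := fun hpq => hpq.trans (by linarith)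
  have rfl' : ∀ {p : H}, ‖p - p‖ ≤ δ := fun {p} => by simpa using hδ
  have sqr : ∀ {i : Fin 6}, ‖x - A i (A i x)‖ ≤ δ := fun {i} => by
    rw [(hA i).apply_apply]; exact rfl'
  have m0 : ‖-A 0 x - -A 3 x‖ ≤ δ := by rwa [← neg_sub', norm_neg]
  have m1 : ‖-A 1 x - -A 4 x‖ ≤ δ := by rwa [← neg_sub', norm_neg]
  have m2 : ‖A 2 x - -A 5 x‖ ≤ δ := by rwa [sub_neg_eq_add]
  have m2' : ‖-A 2 x - A 5 x‖ ≤ δ := by rwa [← neg_add', norm_neg]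
  have mneg : ∀ {i : Fin 6} {p q : H}, ‖q - A i p‖ ≤ δ → ‖-q - A i (-p)‖ ≤ δ := by
    intro i p q hpq
    rwa [map_neg, ← neg_sub', norm_neg]
  match i, k with
  | 0, 0 => exact pos rfl (one rfl')
  | 0, 1 => exact pos rfl (one sqr)
  | 0, 2 => exact pos rfl (one h.c_ab)
  | 0, 3 => exact pos rfl (one h.b_ac)
  | 1, 0 => exact pos rfl (one rfl')
  | 1, 1 => exact pos rfl (one h.c_ba)
  | 1, 2 => exact pos rfl (one sqr)
  | 1, 3 => exact pos rfl (one h.a_bc)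
  | 2, 0 => exact pos rfl (one rfl')
  | 2, 1 => exact pos rfl (one h.b_ca)
  | 2, 2 => exact pos rfl (one h.a_cb)
  | 2, 3 => exact pos rfl (one sqr)
  | 3, 0 => exact pos rfl (one h0)
  | 3, 1 => exact pos rfl (tri rfl' sqr h0)
  | 3, 2 => exact neg rfl (tri m2' h'.c_ab h1)
  | 3, 3 => exact neg rfl (tri m1 (mneg h'.b_ac) m2)
  | 4, 0 => exact pos rfl (one h1)
  | 4, 1 => exact neg rfl (tri m2' h'.c_ba h0)
  | 4, 2 => exact pos rfl (tri rfl' sqr h1)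
  | 4, 3 => exact neg rfl (tri m0 (mneg h'.a_bc) m2)
  | 5, 0 => exact neg rfl (one m2')
  | 5, 1 => exact pos rfl (tri h1 h'.b_ca h0)
  | 5, 2 => exact pos rfl (tri h0 h'.a_cb h1)
  | 5, 3 => exact neg rfl (tri (q' := -x) rfl' (mneg sqr) m2)

/-- Near the maximum of the temporal expression there is an orthonormal quadruple starting with the
state, on which the observables act almost like the ideal ones on the Bell basis. -/
theorem exists_orthonormal_approx_idealObs {ε : ℝ} (hA : ∀ i, IsDichotomic (A i)) (hx : ‖x‖ = 1)
    (h : temporalValue A x = 5 - ε) (hε : 624 * √ε < 1) :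
    ∃ e : Fin 4 → H, Orthonormal ℂ e ∧ e 0 = x ∧ ∀ i k,
      ‖A i (e k) - ((idealSign i k : ℤ) : ℂ) • e (idealPerm i k)‖ ≤ 2508 * √ε := by
  obtain ⟨-, ht, ht', h0, h1, h2⟩ := approx_relations_of_temporalValue hA hx h
  -- With `δ = 4√ε` the overlaps are at most `16√ε`; this gives the threshold `39·16 = 624` and the
  -- final constant `3·4 + 2·78·16 = 2508`.
  obtain ⟨e, he, he0, hev⟩ := exists_orthonormal_near (norm_stateVector hA hx)
    (norm_inner_stateVector_le hA hx ht ht' h0 h1 h2) (by linarith)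
  refine ⟨e, he, he0, fun i k => ?_⟩
  have e1 := norm_apply_stateVector_sub_le hA ht ht' h0 h1 h2 i k
  have e2 := hev k
  rw [← (hA i).norm_apply_sub] at e2
  have e3 : ‖((idealSign i k : ℤ) : ℂ) • stateVector A x (idealPerm i k)
      - ((idealSign i k : ℤ) : ℂ) • e (idealPerm i k)‖ ≤ 78 * (4 * (4 * √ε)) := by
    rw [← smul_sub, norm_smul, norm_intCast_units, one_mul, norm_sub_rev]
    exact hev _
  have f1 := norm_sub_le_norm_sub_add_norm_sub (A i (e k)) (A i (stateVector A x k))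
    (((idealSign i k : ℤ) : ℂ) • e (idealPerm i k))
  have f2 := norm_sub_le_norm_sub_add_norm_sub (A i (stateVector A x k))
    (((idealSign i k : ℤ) : ℂ) • stateVector A x (idealPerm i k))
    (((idealSign i k : ℤ) : ℂ) • e (idealPerm i k))
  linarith

end Rigidity

end

theorem theorem2 :
    ∃ ε₀ m₁ m₂ s₁ s₂ s₃ : ℝ,
      0 < ε₀ ∧ 0 < m₁ ∧ 0 < m₂ ∧ 0 < s₁ ∧ 0 < s₂ ∧ 0 < s₃ ∧
      ∀ (H : Type*) [NormedAddCommGroup H] [InnerProductSpace ℂ H] [CompleteSpace H]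
        (A : Fin 6 → H →L[ℂ] H) (ψ : H) (ε : ℝ),
        (∀ i, IsDichotomic (A i)) → ‖ψ‖ = 1 →
        temporalValue A ψ = 5 - ε →
        (ε ≤ ε₀ ∨ 4 ≤ Module.rank ℂ H) →
        ∃ (P : H →L[ℂ] TwoQubit) (U : TwoQubit →L[ℂ] TwoQubit),
          P ∘L ContinuousLinearMap.adjoint P = 1 ∧
          U ∈ unitary (TwoQubit →L[ℂ] TwoQubit) ∧
          (∀ i, ‖ContinuousLinearMap.adjoint U
                  ∘L (P ∘L A i ∘L ContinuousLinearMap.adjoint P) ∘L U - idealObs i‖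
                ≤ m₁ * Real.sqrt ε + m₂ * ε ^ (1 / 4 : ℝ)) ∧
          ‖P ψ‖ = 1 ∧
          ‖inner ℂ (ContinuousLinearMap.adjoint U (P ψ)) phiPlus‖ ^ 2
            ≥ 1 - (s₁ * ε + s₂ * ε ^ (3 / 4 : ℝ) + s₃ * Real.sqrt ε) := by
  refine ⟨1 / 1000000, 20000, 1, 1, 1, 1, by norm_num, by norm_num, by norm_num, by norm_num,
    by norm_num, by norm_num, ?_⟩
  intro H _ _ _ A ψ ε hA hψ h hcase
  have hε := (approx_relations_of_temporalValue hA hψ h).1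
  have hs : √(1 / 1000000 : ℝ) = 1 / 1000 := by
    rw [show (1 / 1000000 : ℝ) = (1 / 1000) ^ 2 by norm_num, Real.sqrt_sq (by norm_num)]
  obtain ⟨e, he, he0, hAe⟩ : ∃ e : Fin 4 → H, Orthonormal ℂ e ∧ e 0 = ψ ∧ ∀ i k,
      ‖A i (e k) - ((idealSign i k : ℤ) : ℂ) • e (idealPerm i k)‖ ≤ 5000 * √ε := by
    rcases le_or_gt ε (1 / 1000000) with hsmall | hlarge
    · have hle := Real.sqrt_le_sqrt hsmall
      rw [hs] at hle
      obtain ⟨e, he, he0, hAe⟩ := exists_orthonormal_approx_idealObs hA hψ h (by linarith)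
      exact ⟨e, he, he0, fun i k => (hAe i k).trans (by linarith [Real.sqrt_nonneg ε])⟩
    -- For large `ε` any orthonormal quadruple starting at `ψ` works: the error is at most `2`,
    -- while `5000 √ε ≥ 5`.
    · obtain ⟨e, he, he0⟩ :=
        exists_orthonormal_of_le_rank (hcase.resolve_left (not_le.2 hlarge)) hψ
      have hle := Real.sqrt_le_sqrt hlarge.le
      rw [hs] at hle
      refine ⟨e, he, he0, fun i k => (norm_sub_le _ _).trans ?_⟩
      rw [(hA i).norm_apply, norm_smul, norm_intCast_units, he.1, he.1]
      linarith
  obtain ⟨W, hW, hWe⟩ := exists_isometry_bellVector he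
  have hWψ : ContinuousLinearMap.adjoint W ψ = phiPlus := by
    rw [← he0, ← hWe 0]
    exact congrArg (fun T : TwoQubit →L[ℂ] TwoQubit => T phiPlus) hW
  have hphi : ‖phiPlus‖ = 1 := orthonormal_bellVector.1 0
  have hone : ContinuousLinearMap.adjoint (1 : TwoQubit →L[ℂ] TwoQubit) = 1 := by
    rw [← ContinuousLinearMap.star_eq_adjoint, star_one]
  refine ⟨ContinuousLinearMap.adjoint W, 1, ?_, one_mem _, fun i => ?_, ?_, ?_⟩
  · rwa [ContinuousLinearMap.adjoint_adjoint]
  · rw [hone, ContinuousLinearMap.adjoint_adjoint]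
    have hb := norm_compression_sub_idealObs_le hW (A i) i (c := 5000 * √ε)
      fun k => by rw [hWe, hWe]; exact hAe i k
    refine hb.trans ?_
    have := Real.rpow_nonneg hε (1 / 4)
    linarith
  · rw [hWψ, hphi]
  · have h1 := Real.rpow_nonneg hε (3 / 4)
    have h2 := Real.sqrt_nonneg ε
    rw [hone, hWψ, one_apply_eq_self, inner_self_eq_norm_sq_to_K, hphi]
    norm_num
    linarith
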